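/- Let $G$ be a virtually abelian group with a normal subgroup $Z$ of finite index such that $Z \cong \mathbb{Z}^n$ for some $n \ge 0$. Let $S$ be a finite subset of $G$ that generates $G$ as a monoid, and let $\omega \colon S \to \{1,2,3,\dots\}$ be any weight function. Define the weight of a word $s_1 s_2 \cdots s_l$ over $S$ to be $\omega(s_1) + \cdots + \omega(s_l)$. Let $F$ be a subgroup of $G$ contained in $Z$. Define the weight of a right coset $Fg \in F\backslash G$ to be the minimal weight among all words over $S$ that represent an element of $Fg$, and let $\sigma(k)$ be the (finite) number of right cosets of $F$ in $G$ of weight $k$. Then the weighted growth series of $F\backslash G$ with respect to $S$ and $\omega$, $$\sum_{k=0}^{\infty} \sigma(k) z^k,$$ is rational, i.e. it equals $p(z)/q(z)$ for some polynomials $p, q$ with integer coefficients, $q \neq 0$. -/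

import Mathlib

open Polynomial

namespace CosetGrowth

/-- The element of `G` represented by a word over the set `S`. -/
def eval {G : Type*} [Group G] {S : Set G} (w : List S) : G :=
  (w.map Subtype.val).prod

/-- The weight of a word: the sum of the weights of its letters. -/
def wordWeight {G : Type*} {S : Set G} (ω : S → ℕ) (w : List S) : ℕ :=
  (w.map ω).sum

/-- The set `F \ G` of right cosets `F g`. -/
abbrev RightCosets {G : Type*} [Group G] (F : Subgroup G) : Type _ :=
  Quotient (QuotientGroup.rightRel F)

/-- The right coset `F g`. -/
def rightCoset {G : Type*} [Group G] (F : Subgroup G) (g : G) : RightCosets F :=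
  Quotient.mk (QuotientGroup.rightRel F) g

/-- The weight of a right coset: the minimal weight among all words representing one of its
elements. -/
noncomputable def cosetWeight {G : Type*} [Group G] (F : Subgroup G) {S : Set G} (ω : S → ℕ)
    (c : RightCosets F) : ℕ :=
  sInf {k : ℕ | ∃ w : List S, rightCoset F (eval w) = c ∧ wordWeight ω w = k}

/-- The weighted growth function of `F \ G`: the number of right cosets of weight `k`. -/
noncomputable def cosetGrowth {G : Type*} [Group G] (F : Subgroup G) {S : Set G} (ω : S → ℕ)
    (k : ℕ) : ℕ :=
  Set.ncard {c : RightCosets F | cosetWeight F ω c = k}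

/-- The weighted growth series of `F \ G`, as a formal power series with integer coefficients. -/
noncomputable def cosetGrowthSeries {G : Type*} [Group G] (F : Subgroup G) {S : Set G}
    (ω : S → ℕ) : PowerSeries ℤ :=
  PowerSeries.mk fun k => (cosetGrowth F ω k : ℤ)

/-- A formal power series is rational if it is a quotient `p / q` of two polynomials with
integer coefficients. -/
def IsRational (f : PowerSeries ℤ) : Prop :=
  ∃ p q : ℤ[X], q ≠ 0 ∧ (q : PowerSeries ℤ) * f = (p : PowerSeries ℤ)

/-- The minimum in the definition of `cosetWeight` is attained. -/
theorem exists_word_of_cosetWeight {G : Type*} [Group G] (F : Subgroup G) {S : Set G}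
    (ω : S → ℕ) (hS : Submonoid.closure S = ⊤) (c : RightCosets F) :
    ∃ w : List S, rightCoset F (eval w) = c ∧ wordWeight ω w = cosetWeight F ω c := by
  refine Nat.sInf_mem (s := {k : ℕ | ∃ w : List S, rightCoset F (eval w) = c ∧
    wordWeight ω w = k}) ?_
  obtain ⟨g, rfl⟩ := Quotient.exists_rep c
  obtain ⟨l, hl, hg⟩ := Submonoid.exists_list_of_mem_closure
    (show g ∈ Submonoid.closure S by rw [hS]; trivial)
  refine ⟨_, l.attach.map (fun x => ⟨x.1, hl x.1 x.2⟩), ?_, rfl⟩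
  have : (List.map Subtype.val (l.attach.map (fun x => (⟨x.1, hl x.1 x.2⟩ : S)))) = l := by
    simp [List.map_map, Function.comp_def]
  simp only [eval, this, hg]
  rfl

/-- Only finitely many cosets have a given weight, so that `cosetGrowth` counts a finite set. -/
theorem finite_setOf_cosetWeight_eq {G : Type*} [Group G] (F : Subgroup G) {S : Set G}
    (hfin : S.Finite) (ω : S → ℕ) (hω : ∀ s, 0 < ω s) (hS : Submonoid.closure S = ⊤) (k : ℕ) :
    {c : RightCosets F | cosetWeight F ω c = k}.Finite := by
  have : Finite S := hfin
  refine ((List.finite_length_le S k).image fun w => rightCoset F (eval w)).subset ?_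
  intro c hc
  obtain ⟨w, hw, hk⟩ := exists_word_of_cosetWeight F ω hS c
  refine ⟨w, ?_, hw⟩
  have h : ∀ w : List S, w.length ≤ wordWeight ω w := by
    intro w
    induction w with
    | nil => simp
    | cons a t ih =>
      have := hω a
      simp only [wordWeight, List.map_cons, List.sum_cons, List.length_cons] at ih ⊢
      omega
  have h2 := h w
  rw [hk, hc] at h2
  exact h2

end CosetGrowth

/-! A coset `F g` is determined by the class of `g` in the finite group `G ⧸ Z` and by the class
modulo `F` of its displacement from a transversal of `Z`. Right multiplication by a letter moves the
first component and adds to the second an amount depending only on the first and on the letter.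
Words are thus read by a finite automaton with labels in `Γ × ℕ`, where `Γ = Z / F` and the second
coordinate records the weight.

By Kleene's theorem in commutative monoids (`PathSum.isSemilinearSet`), the label sums of words
ending in a given state form a semilinear set. Adding all multiples of `(0, 1)` keeps it semilinear
and removes the minimum from the problem: its points at level `k` correspond to the cosets of weight
at most `k`. A factor `1 - X` then recovers the growth series.

What remains is `IsSemilinearSet.isRational_growthSeries`. Inclusion–exclusion reduces it to sets `B
+ P` with `B` finite and `P` finitely generated, a class closed under intersection
(`IsFGAct.inter`). Lexicographically least representatives reduce these to lower sets of `Fin n →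
ℕ`, treated by well-founded induction. -/

namespace CosetGrowth

open scoped Pointwise

/-! ### Rational power series -/

namespace IsRational

theorem coe (p : ℤ[X]) : IsRational (p : PowerSeries ℤ) :=
  ⟨p, 1, one_ne_zero, by simp⟩

theorem of_mul {q : ℤ[X]} (hq : q ≠ 0) {f : PowerSeries ℤ}
    (h : IsRational ((q : PowerSeries ℤ) * f)) : IsRational f := by
  obtain ⟨a, b, hb, hab⟩ := h
  exact ⟨a, b * q, mul_ne_zero hb hq, by rw [Polynomial.coe_mul, mul_assoc, hab]⟩

theorem add {f g : PowerSeries ℤ} (hf : IsRational f) (hg : IsRational g) :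
    IsRational (f + g) := by
  obtain ⟨a, b, hb, hab⟩ := hf
  obtain ⟨c, d, hd, hcd⟩ := hg
  refine ⟨a * d + c * b, b * d, mul_ne_zero hb hd, ?_⟩
  push_cast
  rw [← hab, ← hcd]
  ring

theorem mul {f g : PowerSeries ℤ} (hf : IsRational f) (hg : IsRational g) :
    IsRational (f * g) := by
  obtain ⟨a, b, hb, hab⟩ := hf
  obtain ⟨c, d, hd, hcd⟩ := hg
  refine ⟨a * c, b * d, mul_ne_zero hb hd, ?_⟩
  push_cast
  rw [← hab, ← hcd]
  ring

theorem sub {f g : PowerSeries ℤ} (hf : IsRational f) (hg : IsRational g) :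
    IsRational (f - g) := by
  have h := hf.add ((coe (-1)).mul hg)
  simpa [sub_eq_add_neg] using h

theorem sum {ι : Type*} (s : Finset ι) {f : ι → PowerSeries ℤ}
    (hf : ∀ i ∈ s, IsRational (f i)) : IsRational (∑ i ∈ s, f i) := by
  classical
  induction s using Finset.induction_on with
  | empty => simpa using coe 0
  | insert i s hi ih =>
    rw [Finset.sum_insert hi]
    exact (hf i (s.mem_insert_self i)).add (ih fun j hj => hf j (Finset.mem_insert_of_mem hj))

end IsRational

theorem X_pow_sub_one_ne_zero {n : ℕ} (hn : 0 < n) : (X ^ n - 1 : ℤ[X]) ≠ 0 :=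
  (monic_X_pow_sub_C (1 : ℤ) hn.ne').ne_zero

/-! ### Growth series of a set -/

/-- The generating function counting the elements of `s` by the value of `h`. -/
noncomputable def growthSeries {α : Type*} (h : α → ℕ) (s : Set α) : PowerSeries ℤ :=
  PowerSeries.mk fun k => ({x | x ∈ s ∧ h x = k}.ncard : ℤ)

section growthSeries

variable {α β : Type*} {h : α → ℕ}

theorem growthSeries_union_add_inter (hfin : ∀ k, {x | h x = k}.Finite) (s t : Set α) :
    growthSeries h (s ∪ t) + growthSeries h (s ∩ t) = growthSeries h s + growthSeries h t := by
  ext k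
  simp only [growthSeries, map_add, PowerSeries.coeff_mk]
  norm_cast
  have hs : {x | x ∈ s ∧ h x = k}.Finite := (hfin k).subset fun x hx => hx.2
  have ht : {x | x ∈ t ∧ h x = k}.Finite := (hfin k).subset fun x hx => hx.2
  rw [← Set.ncard_union_add_ncard_inter _ _ hs ht]
  congr 2
  · ext x
    grind
  · ext x
    grind

theorem growthSeries_empty : growthSeries h ∅ = 0 := by
  ext k
  simp [growthSeries]

theorem growthSeries_union (hfin : ∀ k, {x | h x = k}.Finite) {s t : Set α} (hst : Disjoint s t) :
    growthSeries h (s ∪ t) = growthSeries h s + growthSeries h t := by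
  rw [← growthSeries_union_add_inter hfin, hst.inter_eq, growthSeries_empty, add_zero]

/-- Growth series are compatible with injections that shift the weight. -/
theorem growthSeries_image {h' : β → ℕ} {c : ℕ} {f : β → α} {s : Set β} (hf : Set.InjOn f s)
    (hc : ∀ x ∈ s, h (f x) = c + h' x) :
    growthSeries h (f '' s) = (PowerSeries.X : PowerSeries ℤ) ^ c * growthSeries h' s := by
  ext k
  rw [PowerSeries.coeff_X_pow_mul']
  simp only [growthSeries, PowerSeries.coeff_mk]
  have key : {x | x ∈ f '' s ∧ h x = k} = f '' {x | x ∈ s ∧ c + h' x = k} := by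
    ext y
    constructor
    · rintro ⟨⟨x, hx, rfl⟩, hy⟩
      exact ⟨x, ⟨hx, by rw [← hc x hx, hy]⟩, rfl⟩
    · rintro ⟨x, ⟨hx, hk⟩, rfl⟩
      exact ⟨⟨x, hx, rfl⟩, by rw [hc x hx, hk]⟩
  rw [key, Set.InjOn.ncard_image (hf.mono fun x hx => hx.1)]
  split_ifs with hck
  · have : {x | x ∈ s ∧ c + h' x = k} = {x | x ∈ s ∧ h' x = k - c} := by
      ext x
      exact and_congr_right fun _ => by omega
    rw [this]
  · have : {x | x ∈ s ∧ c + h' x = k} = ∅ := by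
      ext x
      exact iff_of_false (fun hx => hck (hx.2 ▸ Nat.le_add_right _ _)) (Set.notMem_empty x)
    rw [this, Set.ncard_empty, Nat.cast_zero]

theorem isRational_growthSeries_of_finite {s : Set α} (hs : s.Finite) :
    IsRational (growthSeries h s) := by
  classical
  refine ⟨∑ x ∈ hs.toFinset, X ^ h x, 1, one_ne_zero, ?_⟩
  rw [Polynomial.coe_one, one_mul]
  ext k
  rw [Polynomial.coeff_coe, Polynomial.finsetSum_coeff]
  simp only [growthSeries, PowerSeries.coeff_mk, coeff_X_pow]
  rw [Finset.sum_boole, ← Set.ncard_coe_finset]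
  congr 2
  ext x
  simp [eq_comm]

end growthSeries

/-! ### Lower sets of `ι → ℕ` -/

/-- In a descending chain pick `x n` lost at step `n`. Some `m < n` has `x m ≤ x n ∈ D n ⊆ D (m +
1)`, so `x m` was not lost. -/
theorem wellFounded_lowerSet {α : Type*} [Preorder α] [WellQuasiOrderedLE α] :
    WellFounded fun s t : LowerSet α => s < t := by
  rw [RelEmbedding.wellFounded_iff_isEmpty]
  refine ⟨fun D => ?_⟩
  have hD : ∀ m n, m < n → D n < D m := fun m n hmn => D.map_rel_iff.2 hmn
  have hx : ∀ n, ∃ x, x ∈ D n ∧ x ∉ D (n + 1) := fun n =>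
    Set.not_subset.1 (hD n (n + 1) n.lt_succ_self).not_ge
  choose x hx hx' using hx
  obtain ⟨m, n, hmn, hle⟩ := wellQuasiOrdered_le x
  have h1 : D n ≤ D (m + 1) := by
    rcases (Nat.succ_le_of_lt hmn).eq_or_lt with h | h
    · exact (congrArg D h).ge
    · exact (hD _ _ h).le
  exact hx' m ((D (m + 1)).lower hle (h1 (hx n)))

section LowerSet

variable {ι : Type*}

/-- The elements of a lower set whose `i`-th coordinate vanishes. -/
def zeroSlice (D : LowerSet (ι → ℕ)) (i : ι) : LowerSet (ι → ℕ) where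
  carrier := {x | x ∈ D ∧ x i = 0}
  lower' _ _ hyx hx := ⟨D.lower hyx hx.1, Nat.le_zero.1 (hx.2 ▸ hyx i)⟩

/-- The elements that stay in a lower set after increasing the `i`-th coordinate. -/
def shift [DecidableEq ι] (D : LowerSet (ι → ℕ)) (i : ι) : LowerSet (ι → ℕ) where
  carrier := {x | x + Pi.single i 1 ∈ D}
  lower' _ _ hyx hx := D.lower (add_le_add_left hyx _) hx

theorem mem_shift [DecidableEq ι] {D : LowerSet (ι → ℕ)} {i : ι} {x : ι → ℕ} :
    x ∈ shift D i ↔ x + Pi.single i 1 ∈ D := Iff.rfl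

/-- The growth series of a lower set of `ι → ℕ`, for a linear weight with positive coefficients,
is rational. -/
theorem isRational_growthSeries_lowerSet [Finite ι] (h : (ι → ℕ) → ℕ) (w : ι → ℕ)
    [DecidableEq ι] (hw : ∀ i, 0 < w i) (hadd : ∀ i x, h (x + Pi.single i 1) = w i + h x)
    (hfin : ∀ k, {x | h x = k}.Finite) (D : LowerSet (ι → ℕ)) :
    IsRational (growthSeries h (D : Set (ι → ℕ))) := by
  refine wellFounded_lowerSet.induction
    (C := fun D : LowerSet (ι → ℕ) => IsRational (growthSeries h (D : Set (ι → ℕ)))) D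
    fun D ih => ?_
  by_cases hD : ∀ i, zeroSlice D i = D
  · refine isRational_growthSeries_of_finite ((Set.finite_singleton (0 : ι → ℕ)).subset ?_)
    intro x hx
    ext i
    have hx' : x ∈ zeroSlice D i := by rw [hD i]; exact hx
    exact hx'.2
  push Not at hD
  obtain ⟨i, hi⟩ := hD
  have hlt : zeroSlice D i < D := lt_of_le_of_ne (fun x hx => hx.1) hi
  have hle : shift D i ≤ D := fun x hx => D.lower (le_self_add) hx
  have hdec : (D : Set (ι → ℕ)) = (zeroSlice D i : Set (ι → ℕ)) ∪
      (fun x => x + Pi.single i 1) '' (shift D i : Set (ι → ℕ)) := by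
    ext x
    constructor
    · intro hx
      by_cases hxi : x i = 0
      · exact Or.inl ⟨hx, hxi⟩
      · have hx' : x - Pi.single i 1 + Pi.single i 1 = x := by
          refine tsub_add_cancel_of_le fun j => ?_
          by_cases hj : j = i
          · subst hj; simp; omega
          · simp [hj]
        exact Or.inr ⟨x - Pi.single i 1, by
          rw [SetLike.mem_coe, mem_shift, hx']; exact hx, hx'⟩
    · rintro (hx | ⟨y, hy, rfl⟩)
      · exact hx.1
      · exact hy
  have hdisj : Disjoint (zeroSlice D i : Set (ι → ℕ))
      ((fun x => x + Pi.single i 1) '' (shift D i : Set (ι → ℕ))) := by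
    rw [Set.disjoint_right]
    rintro _ ⟨y, -, rfl⟩ hy
    have := hy.2
    simp at this
  have heq : growthSeries h (D : Set (ι → ℕ)) = growthSeries h (zeroSlice D i : Set (ι → ℕ)) +
      PowerSeries.X ^ w i * growthSeries h (shift D i : Set (ι → ℕ)) := by
    conv_lhs => rw [hdec]
    rw [growthSeries_union hfin hdisj, growthSeries_image (add_left_injective _).injOn
      fun x _ => hadd i x]
  -- If `shift D i = D`, then `heq` is a linear equation for the series of `D`, solved by dividing
  -- by `X ^ w i - 1`. Otherwise both pieces are strictly smaller than `D`.
  rcases hle.eq_or_lt with hs | hs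
  · rw [hs] at heq
    refine IsRational.of_mul (X_pow_sub_one_ne_zero (hw i)) ?_
    have : ((X ^ w i - 1 : ℤ[X]) : PowerSeries ℤ) * growthSeries h (D : Set (ι → ℕ)) =
        ((0 : ℤ[X]) : PowerSeries ℤ) - growthSeries h (zeroSlice D i : Set (ι → ℕ)) := by
      push_cast
      linear_combination -heq
    rw [this]
    exact (IsRational.coe 0).sub (ih _ hlt)
  · rw [heq]
    refine (ih _ hlt).add (IsRational.mul ?_ (ih _ hs))
    simpa using IsRational.coe (X ^ w i)

end LowerSet

/-! ### Translates of finitely generated submonoids -/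

section FGAct

variable {M : Type*} [AddCommMonoid M]

/-- Discarding the generator `0` makes every basis vector acquire positive weight later on. -/
theorem exists_addMonoidHom_of_fg {P : AddSubmonoid M} (hP : P.FG) :
    ∃ (n : ℕ) (f : (Fin n → ℕ) →+ M), AddMonoidHom.mrange f = P ∧ ∀ i, f (Pi.single i 1) ≠ 0 := by
  classical
  obtain ⟨t, rfl⟩ := hP
  let s := t.erase 0
  let g : Fin s.card → M := fun i => s.equivFin.symm i
  have hg : Set.range g = (s : Set M) := by
    ext x
    constructor
    · rintro ⟨i, rfl⟩
      exact (s.equivFin.symm i).2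
    · intro hx
      exact ⟨s.equivFin ⟨x, hx⟩, by simp [g]⟩
  have hs : AddSubmonoid.closure (t : Set M) = AddSubmonoid.closure (Set.range g) := by
    rw [hg, ← AddSubmonoid.closure_sdiff_singleton_zero, Finset.coe_erase]
  let f : (Fin s.card → ℕ) →+ M := (Fintype.linearCombination ℕ g).toAddMonoidHom
  have hf : ∀ i, f (Pi.single i 1) = g i := fun i => by
    simp [f, Fintype.linearCombination_apply_single]
  refine ⟨s.card, f, ?_, fun i => ?_⟩
  · rw [hs]
    apply le_antisymm
    · rintro _ ⟨x, rfl⟩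
      change (Fintype.linearCombination ℕ g) x ∈ _
      rw [Fintype.linearCombination_apply]
      exact sum_mem fun i _ => nsmul_mem (AddSubmonoid.subset_closure (Set.mem_range_self i)) _
    · rw [AddSubmonoid.closure_le]
      rintro _ ⟨i, rfl⟩
      exact ⟨_, hf i⟩
  · rw [hf]
    exact (Finset.mem_erase.1 (s.equivFin.symm i).2).1

/-- A finite union of translates of one finitely generated submonoid. -/
def IsFGAct (s : Set M) : Prop :=
  ∃ (B : Set M) (P : AddSubmonoid M), B.Finite ∧ P.FG ∧ s = B + (P : Set M)

theorem _root_.IsLinearSet.isFGAct {s : Set M} (hs : IsLinearSet s) : IsFGAct s := by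
  obtain ⟨a, P, hP, rfl⟩ := isLinearSet_iff_exists_fg_eq_vadd.1 hs
  exact ⟨{a}, P, Set.finite_singleton a, hP, by rw [Set.singleton_add]; rfl⟩

/-- When `b` joins `B`, each new point has a unique lexicographically least exponent vector. These
vectors form a lower set: failure to be new or to be least persists under adding `z`. -/
theorem isRational_growthSeries_add_mrange (h : M →+ ℕ) (h0 : ∀ x, h x = 0 → x = 0)
    (hfin : ∀ k, {x | h x = k}.Finite) {n : ℕ} (f : (Fin n → ℕ) →+ M)
    (hf : ∀ i, f (Pi.single i 1) ≠ 0) {B : Set M} (hB : B.Finite) :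
    IsRational (growthSeries h (B + (AddMonoidHom.mrange f : Set M))) := by
  induction B, hB using Set.Finite.induction_on with
  | empty =>
    rw [Set.empty_add, growthSeries_empty]
    simpa using IsRational.coe 0
  | @insert b B hb hB ih =>
    have hstable : ∀ x y, x ∈ B + (AddMonoidHom.mrange f : Set M) → x + f y ∈ B + (AddMonoidHom.mrange f : Set M) := by
      rintro _ y ⟨c, hc, p, hp, rfl⟩
      exact ⟨c, hc, p + f y, add_mem hp ⟨y, rfl⟩, (add_assoc _ _ _).symm⟩
    let D : LowerSet (Fin n → ℕ) :=
      { carrier := {x | b + f x ∉ B + (AddMonoidHom.mrange f : Set M) ∧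
          ∀ y, toLex y < toLex x → b + f y ≠ b + f x}
        lower' := by
          rintro x y hyx ⟨hx1, hx2⟩
          obtain ⟨z, rfl⟩ := exists_add_of_le hyx
          refine ⟨fun hy => hx1 ?_, fun u hu huy => hx2 (u + z) ?_ ?_⟩
          · rw [map_add, ← add_assoc]
            exact hstable _ _ hy
          · rw [toLex_add, toLex_add]
            exact add_lt_add_left hu _
          · rw [map_add, map_add, ← add_assoc, huy, add_assoc] }
    have hdec : insert b B + (AddMonoidHom.mrange f : Set M) =
        (B + (AddMonoidHom.mrange f : Set M)) ∪ (fun x => b + f x) '' (D : Set (Fin n → ℕ)) := by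
      ext z
      constructor
      · rintro ⟨c, hc, _, ⟨x, rfl⟩, rfl⟩
        rcases hc with rfl | hc
        · by_cases hx : c + f x ∈ B + (AddMonoidHom.mrange f : Set M)
          · exact Or.inl hx
          · obtain ⟨y, hy, hmin⟩ := WellFounded.has_min
              (wellFounded_lt (α := Lex (Fin n → ℕ))) {y | c + f (ofLex y) = c + f x}
              ⟨toLex x, rfl⟩
            have hy' : c + f (ofLex y) = c + f x := hy
            refine Or.inr ⟨ofLex y, ⟨by rwa [hy'], fun u hu huy => ?_⟩, hy'⟩
            exact hmin (toLex u) (huy.trans hy') hu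
        · exact Or.inl ⟨c, hc, _, ⟨x, rfl⟩, rfl⟩
      · rintro (⟨c, hc, p, hp, rfl⟩ | ⟨x, -, rfl⟩)
        · exact ⟨c, Or.inr hc, p, hp, rfl⟩
        · exact ⟨b, Or.inl rfl, f x, ⟨x, rfl⟩, rfl⟩
    have hdisj : Disjoint (B + (AddMonoidHom.mrange f : Set M))
        ((fun x => b + f x) '' (D : Set (Fin n → ℕ))) := by
      rw [Set.disjoint_right]
      rintro _ ⟨x, hx, rfl⟩
      exact hx.1
    have hinj : Set.InjOn (fun x => b + f x) (D : Set (Fin n → ℕ)) := by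
      intro x hx y hy hxy
      rcases lt_trichotomy (toLex x) (toLex y) with hlt | heq | hlt
      · exact absurd hxy (hy.2 x hlt)
      · exact toLex_inj.1 heq
      · exact absurd hxy.symm (hx.2 y hlt)
    have hw : ∀ i, 0 < h (f (Pi.single i 1)) := fun i =>
      Nat.pos_of_ne_zero fun hi => hf i (h0 _ hi)
    have hfin' : ∀ k, {x | h (f x) = k}.Finite := by
      intro k
      refine (Set.finite_Iic (fun _ : Fin n => k)).subset fun x hx i => ?_
      obtain ⟨z, hz⟩ := exists_add_of_le (show x i • Pi.single i 1 ≤ x by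
        intro j
        by_cases hj : j = i
        · subst hj; simp
        · simp [hj])
      have hx' : h (f x) = k := hx
      rw [hz, map_add, map_add, map_nsmul, map_nsmul, smul_eq_mul] at hx'
      calc x i ≤ x i * h (f (Pi.single i 1)) := Nat.le_mul_of_pos_right _ (hw i)
        _ ≤ k := hx' ▸ Nat.le_add_right _ _
    rw [hdec, growthSeries_union hfin hdisj, growthSeries_image (h' := fun x => h (f x)) hinj
      fun x _ => map_add h _ _]
    refine ih.add (IsRational.mul ?_ (isRational_growthSeries_lowerSet _ _ hw ?_ hfin' D))
    · simpa using IsRational.coe (X ^ h b)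
    · intro i x
      rw [map_add, map_add, add_comm]

theorem IsFGAct.isRational_growthSeries {s : Set M} (hs : IsFGAct s) (h : M →+ ℕ)
    (h0 : ∀ x, h x = 0 → x = 0) (hfin : ∀ k, {x | h x = k}.Finite) :
    IsRational (growthSeries h s) := by
  obtain ⟨B, P, hB, hP, rfl⟩ := hs
  obtain ⟨n, f, rfl, hf⟩ := exists_addMonoidHom_of_fg hP
  exact isRational_growthSeries_add_mrange h h0 hfin f hf hB

/-- The intersection is the image of the solution monoid of `f x = g y`, which is finitely
generated. -/
theorem fg_inf [IsCancelAdd M] {P Q : AddSubmonoid M} (hP : P.FG) (hQ : Q.FG) :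
    (P ⊓ Q).FG := by
  obtain ⟨m, f, rfl⟩ := AddSubmonoid.fg_iff_exists_fin_addMonoidHom.1 hP
  obtain ⟨n, g, rfl⟩ := AddSubmonoid.fg_iff_exists_fin_addMonoidHom.1 hQ
  have := (AddSubmonoid.fg_eqLocusM (f.comp (AddMonoidHom.fst (Fin m → ℕ) (Fin n → ℕ)))
    (g.comp (AddMonoidHom.snd (Fin m → ℕ) (Fin n → ℕ)))).map
    (f.comp (AddMonoidHom.fst (Fin m → ℕ) (Fin n → ℕ)))
  convert this using 1
  ext z
  constructor
  · rintro ⟨⟨x, rfl⟩, ⟨y, hy⟩⟩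
    exact ⟨(x, y), hy.symm, rfl⟩
  · rintro ⟨⟨x, y⟩, hxy, rfl⟩
    exact ⟨⟨x, rfl⟩, ⟨y, hxy.symm⟩⟩

theorem mem_add_mrange {N : Type*} [AddCommMonoid N] {f : N →+ M} {B : Set M} {z : M} :
    z ∈ B + (AddMonoidHom.mrange f : Set M) ↔ ∃ b ∈ B, ∃ x, b + f x = z := by
  simp [Set.mem_add]

/-- The equation `b + f x = c + g y` has finitely many minimal solutions by Dickson's lemma. Any
solution exceeds a minimal one by some `(v, w)`, and cancellation gives `f v = g w`, an element of
`P ⊓ Q`. -/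
theorem IsFGAct.inter [IsCancelAdd M] {s t : Set M} (hs : IsFGAct s) (ht : IsFGAct t) :
    IsFGAct (s ∩ t) := by
  obtain ⟨B, P, hB, hP, rfl⟩ := hs
  obtain ⟨C, Q, hC, hQ, rfl⟩ := ht
  have hR := fg_inf hP hQ
  obtain ⟨m, f, rfl⟩ := AddSubmonoid.fg_iff_exists_fin_addMonoidHom.1 hP
  obtain ⟨n, g, rfl⟩ := AddSubmonoid.fg_iff_exists_fin_addMonoidHom.1 hQ
  let E : M → M → Set ((Fin m → ℕ) × (Fin n → ℕ)) := fun b c =>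
    {x | Minimal (fun x => b + f x.1 = c + g x.2) x}
  have hE : ∀ b c, (E b c).Finite := fun b c =>
    (setOfPred_minimal_antichain _).finite_of_partiallyWellOrderedOn
      (Set.isPWO_of_wellQuasiOrderedLE _)
  have hF := hB.biUnion fun b _ => hC.biUnion fun c _ => (hE b c).image fun x => b + f x.1
  refine ⟨_, _, hF, hR, ?_⟩
  ext z
  constructor
  · rintro ⟨hz1, hz2⟩
    obtain ⟨b, hb, x, rfl⟩ := mem_add_mrange.1 hz1
    obtain ⟨c, hc, y, hxy⟩ := mem_add_mrange.1 hz2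
    obtain ⟨u, hu, hmin⟩ := exists_minimal_le_of_wellFoundedLT
      (fun x : (Fin m → ℕ) × (Fin n → ℕ) => b + f x.1 = c + g x.2) (x, y) hxy.symm
    obtain ⟨v, rfl⟩ := exists_add_of_le hu.1
    obtain ⟨w, rfl⟩ := exists_add_of_le hu.2
    have h1 : b + f u.1 = c + g u.2 := hmin.prop
    rw [map_add, map_add, ← add_assoc, ← add_assoc, h1] at hxy
    refine Set.mem_add.2 ⟨b + f u.1, Set.mem_biUnion hb (Set.mem_biUnion hc ⟨u, hmin, rfl⟩),
      f v, ⟨⟨v, rfl⟩, ⟨w, add_left_cancel hxy⟩⟩, ?_⟩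
    rw [map_add, add_assoc]
  · intro hz
    obtain ⟨a, ha, r, ⟨⟨v, rfl⟩, ⟨w, hw⟩⟩, rfl⟩ := Set.mem_add.1 hz
    obtain ⟨b, hb, hz⟩ := Set.mem_iUnion₂.1 ha
    obtain ⟨c, hc, x, hx, rfl⟩ := Set.mem_iUnion₂.1 hz
    have h1 : b + f x.1 = c + g x.2 :=
      Minimal.prop (P := fun x : (Fin m → ℕ) × (Fin n → ℕ) => b + f x.1 = c + g x.2) hx
    refine ⟨mem_add_mrange.2 ⟨b, hb, x.1 + v, ?_⟩, mem_add_mrange.2 ⟨c, hc, x.2 + w, ?_⟩⟩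
    · rw [map_add, add_assoc]
    · rw [map_add, hw, ← add_assoc, ← h1]

/-- The growth series of a semilinear set in a cancellative commutative monoid is rational. -/
theorem _root_.IsSemilinearSet.isRational_growthSeries [IsCancelAdd M] {s : Set M}
    (hs : IsSemilinearSet s) (h : M →+ ℕ) (h0 : ∀ x, h x = 0 → x = 0)
    (hfin : ∀ k, {x | h x = k}.Finite) : IsRational (growthSeries h s) := by
  have key : ∀ l : List (Set M), (∀ t ∈ l, IsFGAct t) →
      IsRational (growthSeries h (⋃ t ∈ l, t)) := by
    intro l
    -- Induction is on the length because inclusion–exclusion also needs the list of intersections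
    -- `t ∩ u`, which is as long as the tail but different from it.
    induction hl : l.length generalizing l with
    | zero =>
      intro _
      rw [List.length_eq_zero_iff.1 hl]
      simpa [growthSeries_empty] using IsRational.coe 0
    | succ n ih =>
      intro hact
      obtain ⟨t, l, rfl⟩ := List.exists_cons_of_length_eq_add_one hl
      have hl' : l.length = n := by simpa using hl
      have h1 : (⋃ u ∈ t :: l, u) = t ∪ ⋃ u ∈ l, u := by ext x; simp
      have h2 : t ∩ (⋃ u ∈ l, u) = ⋃ u ∈ l.map (fun u => t ∩ u), u := by ext x; simp
      rw [h1, eq_sub_of_add_eq (growthSeries_union_add_inter hfin t _), h2]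
      refine ((hact t (by simp)).isRational_growthSeries h h0 hfin |>.add
        (ih l hl' fun u hu => hact u (by simp [hu]))).sub (ih _ (by simpa using hl') ?_)
      intro v hv
      obtain ⟨u, hu, rfl⟩ := List.mem_map.1 hv
      exact (hact t (by simp)).inter (hact u (by simp [hu]))
  obtain ⟨T, hT, hT', rfl⟩ := hs
  convert key hT.toFinset.toList fun t ht => (hT' t (by simpa using ht)).isFGAct
  ext x
  simp

end FGAct

/-! ### Label sums of paths in a finite labelled graph -/

/-- `PathSum E A p q m`: the element `m` is the sum of the labels along a nonempty path from `p`
to `q` all of whose intermediate vertices lie in `A`, where `E p q` is the set of labels of the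
edges from `p` to `q`. -/
inductive PathSum {Q M : Type*} [Add M] (E : Q → Q → Set M) (A : Set Q) : Q → Q → M → Prop
  | edge {p q m} : m ∈ E p q → PathSum E A p q m
  | trans {p r q m m'} : PathSum E A p r m → r ∈ A → PathSum E A r q m' →
      PathSum E A p q (m + m')

namespace PathSum

variable {Q M : Type*}

theorem mono [Add M] {E : Q → Q → Set M} {A A' : Set Q} (hA : A ⊆ A') {p q : Q} {m : M}
    (h : PathSum E A p q m) : PathSum E A' p q m := by
  induction h with
  | edge h => exact edge h
  | trans _ hr _ ih1 ih2 => exact trans ih1 (hA hr) ih2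

variable [AddCommMonoid M] {E : Q → Q → Set M}

theorem add_closure {A : Set Q} {a p : Q} (ha : a ∈ A) {m c : M} (hm : PathSum E A p a m)
    (hc : c ∈ AddSubmonoid.closure {m | PathSum E A a a m}) : PathSum E A p a (m + c) := by
  induction hc using AddSubmonoid.closure_induction generalizing m with
  | mem c hc => exact hm.trans ha hc
  | zero => simpa
  | add c d _ _ hc hd =>
    rw [← add_assoc]
    exact hd (hc hm)

/-- Kleene's recursion: cut a path at its visits to `a`. Between the first and last visits it is a
sum of loops, possibly empty, whence the closure. -/
theorem insert_iff {A : Set Q} {a p q : Q} {m : M} :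
    PathSum E (insert a A) p q m ↔ PathSum E A p q m ∨
      ∃ x c y, PathSum E A p a x ∧ c ∈ AddSubmonoid.closure {m | PathSum E A a a m} ∧
        PathSum E A a q y ∧ m = x + c + y := by
  constructor
  · intro h
    induction h with
    | edge h => exact Or.inl (edge h)
    | @trans p r q m m' _ hr _ ih1 ih2 =>
      rcases hr with rfl | hr
      · have h1 : ∃ x c, PathSum E A p r x ∧
            c ∈ AddSubmonoid.closure {m | PathSum E A r r m} ∧ m = x + c := by
          rcases ih1 with h | ⟨x, c, y, hx, hc, hy, rfl⟩
          · exact ⟨m, 0, h, zero_mem _, (add_zero m).symm⟩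
          · exact ⟨x, c + y, hx, add_mem hc (AddSubmonoid.subset_closure hy), add_assoc _ _ _⟩
        have h2 : ∃ c y, c ∈ AddSubmonoid.closure {m | PathSum E A r r m} ∧
            PathSum E A r q y ∧ m' = c + y := by
          rcases ih2 with h | ⟨x, c, y, hx, hc, hy, rfl⟩
          · exact ⟨0, m', zero_mem _, h, (zero_add m').symm⟩
          · exact ⟨x + c, y, add_mem (AddSubmonoid.subset_closure hx) hc, hy, rfl⟩
        obtain ⟨x, c, hx, hc, rfl⟩ := h1
        obtain ⟨d, y, hd, hy, rfl⟩ := h2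
        exact Or.inr ⟨x, c + d, y, hx, add_mem hc hd, hy, by simp only [add_assoc]⟩
      · rcases ih1 with h1 | ⟨x, c, y, hx, hc, hy, rfl⟩ <;>
          rcases ih2 with h2 | ⟨x', c', y', hx', hc', hy', rfl⟩
        · exact Or.inl (h1.trans hr h2)
        · exact Or.inr ⟨m + x', c', y', h1.trans hr hx', hc', hy', by simp only [add_assoc]⟩
        · exact Or.inr ⟨x, c, y + m', hx, hc, hy.trans hr h2, by simp only [add_assoc]⟩
        · exact Or.inr ⟨x, c + (y + x') + c', y', hx,
            add_mem (add_mem hc (AddSubmonoid.subset_closure (hy.trans hr hx'))) hc', hy',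
            by simp only [add_assoc]⟩
  · rintro (h | ⟨x, c, y, hx, hc, hy, rfl⟩)
    · exact h.mono (Set.subset_insert a A)
    · have hsub := Set.subset_insert a A
      refine ((hx.mono hsub).add_closure (Set.mem_insert a A) ?_).trans (Set.mem_insert a A)
        (hy.mono hsub)
      exact AddSubmonoid.closure_mono (fun m hm => PathSum.mono hsub hm) hc

/-- **Kleene's theorem** in a commutative monoid: the sums of the labels along the paths between
two vertices of a finite graph form a semilinear set. -/
theorem isSemilinearSet (hE : ∀ p q, IsSemilinearSet (E p q)) {A : Set Q} (hA : A.Finite)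
    (p q : Q) : IsSemilinearSet {m | PathSum E A p q m} := by
  induction A, hA using Set.Finite.induction_on generalizing p q with
  | empty =>
    convert hE p q using 1
    ext m
    refine ⟨fun h => ?_, edge⟩
    cases h with
    | edge h => exact h
    | trans _ hr _ => exact absurd hr (Set.notMem_empty _)
  | @insert a A _ _ ih =>
    convert (ih p q).union (((ih p a).add (ih a a).closure).add (ih a q)) using 1
    ext m
    refine insert_iff.trans (or_congr_right ?_)
    constructor
    · rintro ⟨x, c, y, hx, hc, hy, rfl⟩
      exact ⟨_, ⟨x, hx, c, hc, rfl⟩, y, hy, rfl⟩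
    · rintro ⟨_, ⟨x, hx, c, hc, rfl⟩, y, hy, rfl⟩
      exact ⟨x, c, y, hx, hc, hy, rfl⟩

end PathSum

/-! ### Words read by a finite labelled automaton. -/

section Automaton

variable {Q S M : Type*} [AddCommMonoid M]

/-- The sum of the labels read along a word by a deterministic automaton. -/
def labelSum (δ : Q → S → Q) (l : Q → S → M) : Q → List S → M
  | _, [] => 0
  | p, s :: w => l p s + labelSum δ l (δ p s) w

theorem labelSum_append (δ : Q → S → Q) (l : Q → S → M) (p : Q) (v w : List S) :
    labelSum δ l p (v ++ w) = labelSum δ l p v + labelSum δ l (v.foldl δ p) w := by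
  induction v generalizing p with
  | nil => simp [labelSum]
  | cons s v ih => simp [labelSum, ih, add_assoc]

/-- The label sums of the words that lead from one state of a finite automaton to another form a
semilinear set. -/
theorem isSemilinearSet_labelSum [Finite Q] [Finite S] (δ : Q → S → Q) (l : Q → S → M)
    (p q : Q) : IsSemilinearSet {m | ∃ w : List S, w.foldl δ p = q ∧ labelSum δ l p w = m} := by
  let E : Q → Q → Set M := fun p q => l p '' {s | δ p s = q}
  have hE : ∀ p q, IsSemilinearSet (E p q) := fun p q =>
    .of_finite ((Set.toFinite _).image _)
  have h1 : ∀ {p q m}, PathSum E Set.univ p q m →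
      ∃ w : List S, w.foldl δ p = q ∧ labelSum δ l p w = m := by
    intro p q m h
    induction h with
    | edge h =>
      obtain ⟨s, hs, rfl⟩ := h
      exact ⟨[s], hs, by simp [labelSum]⟩
    | trans _ _ _ ih1 ih2 =>
      obtain ⟨v, rfl, rfl⟩ := ih1
      obtain ⟨w, rfl, rfl⟩ := ih2
      exact ⟨v ++ w, List.foldl_append, labelSum_append _ _ _ _ _⟩
  have h2 : ∀ (w : List S) (p : Q), w ≠ [] →
      PathSum E Set.univ p (w.foldl δ p) (labelSum δ l p w) := by
    intro w
    induction w with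
    | nil => exact fun p h => absurd rfl h
    | cons s w ih =>
      intro p _
      have hs : PathSum E Set.univ p (δ p s) (l p s) := .edge ⟨s, rfl, rfl⟩
      by_cases hw : w = []
      · subst hw
        simpa [labelSum] using hs
      · exact hs.trans (Set.mem_univ _) (ih _ hw)
  -- `PathSum` covers nonempty words only; the second set accounts for the empty word.
  convert (PathSum.isSemilinearSet hE Set.finite_univ p q).union
    (.of_finite (s := {m : M | p = q ∧ m = 0})
      ((Set.finite_singleton 0).subset fun m hm => hm.2)) using 1
  ext m
  constructor
  · rintro ⟨w, rfl, rfl⟩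
    by_cases hw : w = []
    · subst hw
      exact Or.inr ⟨rfl, rfl⟩
    · exact Or.inl (h2 w p hw)
  · rintro (h | ⟨rfl, rfl⟩)
    · exact h1 h
    · exact ⟨[], rfl, rfl⟩

end Automaton

/-! ### Submonoids generated by finitely many elements of positive weight. -/

section Graded

variable {N : Type*} [AddCommMonoid N]

theorem exists_add_of_mem_closure {T : Set N} {x : N} (hx : x ∈ AddSubmonoid.closure T) :
    x = 0 ∨ ∃ t ∈ T, ∃ y ∈ AddSubmonoid.closure T, x = t + y := by
  induction hx using AddSubmonoid.closure_induction_left with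
  | zero => exact Or.inl rfl
  | add_left t ht y hy _ => exact Or.inr ⟨t, ht, y, hy, rfl⟩

theorem eq_zero_of_mem_closure {T : Set N} {h : N →+ ℕ} (hT : ∀ t ∈ T, 0 < h t) {x : N}
    (hx : x ∈ AddSubmonoid.closure T) (h0 : h x = 0) : x = 0 := by
  rcases exists_add_of_mem_closure hx with rfl | ⟨t, ht, y, -, rfl⟩
  · rfl
  · have := hT t ht
    rw [map_add] at h0
    omega

theorem finite_closure_level {T : Set N} (hfin : T.Finite) {h : N →+ ℕ}
    (hT : ∀ t ∈ T, 0 < h t) (k : ℕ) : {x | x ∈ AddSubmonoid.closure T ∧ h x = k}.Finite := by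
  induction k using Nat.strong_induction_on with
  | _ k ih =>
  have hF : (⋃ j ∈ Set.Iio k, T + {x | x ∈ AddSubmonoid.closure T ∧ h x = j}).Finite :=
    (Set.finite_Iio k).biUnion fun j hj => hfin.add (ih j hj)
  refine ((Set.finite_singleton 0).union hF).subset ?_
  rintro x ⟨hx, hk⟩
  rcases exists_add_of_mem_closure hx with rfl | ⟨t, ht, y, hy, rfl⟩
  · exact Or.inl rfl
  · have := hT t ht
    rw [map_add] at hk
    exact Or.inr (Set.mem_biUnion (x := h y) (show h y < k by omega)
      ⟨t, ht, y, ⟨hy, rfl⟩, rfl⟩)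

end Graded

theorem map_labelSum {Q S M N : Type*} [AddCommMonoid M] [AddCommMonoid N] (φ : M →+ N)
    (δ : Q → S → Q) (l : Q → S → M) (w : List S) (p : Q) :
    φ (labelSum δ l p w) = labelSum δ (fun q s => φ (l q s)) p w := by
  induction w generalizing p with
  | nil => simp [labelSum]
  | cons s w ih => simp [labelSum, ih]

theorem labelSum_const {Q S : Type*} (ω : S → ℕ) (δ : Q → S → Q) (w : List S) (p : Q) :
    labelSum δ (fun _ s => ω s) p w = (w.map ω).sum := by
  induction w generalizing p with
  | nil => simp [labelSum]
  | cons s w ih => simp [labelSum, ih]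

/-- Allowing an arbitrary multiple of a fixed element to be added keeps the set of label sums
semilinear. -/
theorem isSemilinearSet_labelSum_add_nsmul {Q S M : Type*} [AddCommMonoid M] [Finite Q] [Finite S]
    (δ : Q → S → Q) (l : Q → S → M) (u : M) (p q : Q) :
    IsSemilinearSet {m | ∃ (w : List S) (j : ℕ), w.foldl δ p = q ∧
      labelSum δ l p w + j • u = m} := by
  convert (isSemilinearSet_labelSum δ l p q).add
    (.closure_of_finite (Set.finite_singleton u)) using 1
  ext m
  constructor
  · rintro ⟨w, j, hw, rfl⟩
    exact Set.mem_add.2 ⟨_, ⟨w, hw, rfl⟩, j • u,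
      AddSubmonoid.mem_closure_singleton.2 ⟨j, rfl⟩, rfl⟩
  · intro hm
    obtain ⟨_, ⟨w, hw, rfl⟩, v, hv, rfl⟩ := Set.mem_add.1 hm
    obtain ⟨j, rfl⟩ := AddSubmonoid.mem_closure_singleton.1 hv
    exact ⟨w, j, hw, rfl⟩

/-! ### From cosets to label sums. -/

section Coset

variable {G : Type*} [Group G] {F : Subgroup G} {S : Set G} {ω : S → ℕ}

theorem cosetWeight_le_iff (hS : Submonoid.closure S = ⊤) {c : RightCosets F} {k : ℕ} :
    cosetWeight F ω c ≤ k ↔ ∃ w : List S, rightCoset F (eval w) = c ∧ wordWeight ω w ≤ k := by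
  constructor
  · intro h
    obtain ⟨w, hw, hk⟩ := exists_word_of_cosetWeight F ω hS c
    exact ⟨w, hw, hk.le.trans h⟩
  · rintro ⟨w, hw, hk⟩
    exact (Nat.sInf_le ⟨w, hw, rfl⟩ : cosetWeight F ω c ≤ wordWeight ω w).trans hk

theorem finite_setOf_cosetWeight_le (hfin : S.Finite) (hω : ∀ s, 0 < ω s)
    (hS : Submonoid.closure S = ⊤) (k : ℕ) :
    {c : RightCosets F | cosetWeight F ω c ≤ k}.Finite := by
  have hF : (⋃ j ∈ Set.Iic k, {c : RightCosets F | cosetWeight F ω c = j}).Finite :=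
    (Set.finite_Iic k).biUnion fun j _ => finite_setOf_cosetWeight_eq F hfin ω hω hS j
  exact hF.subset fun c hc => Set.mem_biUnion (show cosetWeight F ω c ∈ Set.Iic k from hc) rfl

/-- The growth series is `1 - X` times the cumulative growth series. -/
theorem cosetGrowthSeries_eq (hfin : S.Finite) (hω : ∀ s, 0 < ω s)
    (hS : Submonoid.closure S = ⊤) :
    cosetGrowthSeries F ω = (1 - PowerSeries.X) *
      PowerSeries.mk fun k => ({c : RightCosets F | cosetWeight F ω c ≤ k}.ncard : ℤ) := by
  rw [sub_mul, one_mul, eq_sub_iff_add_eq]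
  ext k
  cases k with
  | zero => simp [cosetGrowthSeries, cosetGrowth]
  | succ k =>
    simp only [cosetGrowthSeries, cosetGrowth, map_add, PowerSeries.coeff_mk,
      PowerSeries.coeff_succ_X_mul]
    norm_cast
    rw [← Set.ncard_union_eq _ (finite_setOf_cosetWeight_eq F hfin ω hω hS _)
      (finite_setOf_cosetWeight_le hfin hω hS _)]
    · congr 1
      ext c
      simp only [Set.mem_union, Set.mem_ofPred_eq]
      omega
    · rw [Set.disjoint_left]
      intro c hc hc'
      simp only [Set.mem_ofPred_eq] at hc hc'
      omega

variable {Q Γ : Type*} [AddCommGroup Γ]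

section Word

variable {κ : G → Q} {τ : G → Γ} {δ : Q → S → Q} {l : Q → S → Γ}

theorem apply_mul_eval (hκ : ∀ g (s : S), κ (g * s) = δ (κ g) s) (w : List S) (g : G) :
    κ (g * eval w) = w.foldl δ (κ g) := by
  induction w generalizing g with
  | nil => simp [eval]
  | cons s w ih =>
    rw [List.foldl_cons, ← hκ, ← ih, mul_assoc]
    simp [eval]

theorem cocycle_mul_eval (hκ : ∀ g (s : S), κ (g * s) = δ (κ g) s)
    (hτ : ∀ g (s : S), τ (g * s) = τ g + l (κ g) s) (w : List S) (g : G) :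
    τ (g * eval w) = τ g + labelSum δ l (κ g) w := by
  induction w generalizing g with
  | nil => simp [eval, labelSum]
  | cons s w ih =>
    rw [labelSum, ← hκ, ← add_assoc, ← hτ, ← ih, mul_assoc]
    simp [eval]

end Word

/-- Growth of cosets is rational if the cosets embed in `Q × Γ`, with `Q` finite and `Γ` abelian,
in such a way that right multiplication by a letter acts on `Q`, and translates the `Γ`-component
by an amount depending only on the `Q`-component. -/
theorem isRational_cosetGrowthSeries_of_cocycle [Finite Q] (hfin : S.Finite)
    (hS : Submonoid.closure S = ⊤) (hω : ∀ s, 0 < ω s) (κ : G → Q) (τ : G → Γ)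
    (δ : Q → S → Q) (l : Q → S → Γ) (hκ : ∀ g (s : S), κ (g * s) = δ (κ g) s)
    (hτ : ∀ g (s : S), τ (g * s) = τ g + l (κ g) s)
    (hF : ∀ g g', rightCoset F g = rightCoset F g' ↔ κ g = κ g' ∧ τ g = τ g') :
    IsRational (cosetGrowthSeries F ω) := by
  classical
  have := Fintype.ofFinite Q
  have : Finite S := hfin
  let T : Set (Γ × ℕ) := insert (0, 1) (Set.range fun p : Q × S => (l p.1 p.2, ω p.2))
  have hTfin : T.Finite := (Set.finite_range _).insert _
  have hT : ∀ t ∈ T, 0 < AddMonoidHom.snd Γ ℕ t := by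
    rintro t (rfl | ⟨p, rfl⟩)
    · exact Nat.one_pos
    · exact hω p.2
  -- In `Γ × ℕ` weight zero need not force an element to vanish, and levels may be infinite; both
  -- defects disappear in the submonoid generated by the labels.
  let M := AddSubmonoid.closure T
  let h : M →+ ℕ := (AddMonoidHom.snd Γ ℕ).comp M.subtype
  have h0 : ∀ x, h x = 0 → x = 0 := fun x hx => Subtype.ext (eq_zero_of_mem_closure hT x.2 hx)
  have hlevel : ∀ k, {x | h x = k}.Finite := fun k =>
    Set.Finite.of_finite_image ((finite_closure_level hTfin hT k).subset
      (Set.image_subset_iff.2 fun x hx => ⟨x.2, hx⟩)) Subtype.val_injective.injOn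
  let u : M := ⟨(0, 1), AddSubmonoid.subset_closure (Set.mem_insert _ _)⟩
  let L : Q → S → M := fun q s =>
    ⟨(l q s, ω s), AddSubmonoid.subset_closure (Set.mem_insert_of_mem _ ⟨(q, s), rfl⟩)⟩
  let Y : Q → Set M := fun q =>
    {m | ∃ (w : List S) (j : ℕ), w.foldl δ (κ 1) = q ∧ labelSum δ L (κ 1) w + j • u = m}
  have hY : ∀ q, IsSemilinearSet (Y q) := isSemilinearSet_labelSum_add_nsmul δ L u (κ 1)
  -- Reading starts at the identity, where `τ` need not vanish; hence the offset `τ 1`.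
  have hL1 : ∀ w, (labelSum δ L (κ 1) w).1.1 = τ (eval w) - τ 1 := by
    intro w
    rw [eq_sub_iff_add_eq', ← one_mul (eval w), cocycle_mul_eval hκ hτ]
    exact congrArg _ (map_labelSum ((AddMonoidHom.fst Γ ℕ).comp M.subtype) δ L w (κ 1))
  have hL2 : ∀ w, (labelSum δ L (κ 1) w).1.2 = wordWeight ω w := fun w =>
    (map_labelSum h δ L w (κ 1)).trans (labelSum_const ω δ w (κ 1))
  have hκ1 : ∀ w : List S, w.foldl δ (κ 1) = κ (eval w) := fun w => by
    rw [← apply_mul_eval hκ, one_mul]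
  have hout : ∀ c : RightCosets F, rightCoset F c.out = c := Quotient.out_eq
  -- The slack `j • u` fills the gap between the weight of a word and `k`.
  have hmem : ∀ (q : Q) (g : G) (k : ℕ), κ g = q →
      (cosetWeight F ω (rightCoset F g) ≤ k ↔ ∃ m ∈ Y q, m.1 = (τ g - τ 1, k)) := by
    rintro _ g k rfl
    rw [cosetWeight_le_iff hS]
    constructor
    · rintro ⟨w, hw, hk⟩
      obtain ⟨hw1, hw2⟩ := (hF _ _).1 hw
      refine ⟨_, ⟨w, k - wordWeight ω w, (hκ1 w).trans hw1, rfl⟩, ?_⟩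
      ext
      · simp [hL1, hw2, u]
      · simp [hL2, u, hk]
    · rintro ⟨_, ⟨w, j, hw, rfl⟩, hm⟩
      have hm1 := congrArg Prod.fst hm
      have hm2 := congrArg Prod.snd hm
      simp [hL1, u] at hm1
      simp [hL2, u] at hm2
      exact ⟨w, (hF _ _).2 ⟨(hκ1 w).symm.trans hw, hm1⟩, by omega⟩
  have hcard : ∀ (k : ℕ) (q : Q),
      {c : RightCosets F | cosetWeight F ω c ≤ k ∧ κ c.out = q}.ncard =
        {m | m ∈ Y q ∧ h m = k}.ncard := by
    intro k q
    rw [← Set.ncard_image_of_injective {m | m ∈ Y q ∧ h m = k} Subtype.val_injective,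
      ← Set.InjOn.ncard_image (f := fun c : RightCosets F => (τ c.out - τ 1, k))]
    · congr 1
      ext x
      constructor
      · rintro ⟨c, ⟨hc, hq⟩, rfl⟩
        rw [← hout c, hmem q _ _ hq] at hc
        obtain ⟨m, hm, hmx⟩ := hc
        exact ⟨m, ⟨hm, congrArg Prod.snd hmx⟩, hmx⟩
      · rintro ⟨m, ⟨hm, hk⟩, rfl⟩
        obtain ⟨w, j, hw, hm'⟩ := id hm
        obtain ⟨hc1, hc2⟩ := (hF _ _).1 (hout (rightCoset F (eval w)))
        have hq : κ (rightCoset F (eval w)).out = q := hc1.trans ((hκ1 w).symm.trans hw)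
        have hm1 : m.1 = (τ (rightCoset F (eval w)).out - τ 1, k) := by
          refine Prod.ext ?_ hk
          rw [← hm', hc2]
          simp [hL1, u]
        refine ⟨rightCoset F (eval w), ⟨?_, hq⟩, hm1.symm⟩
        rw [← hout (rightCoset F (eval w)), hmem q _ _ hq]
        exact ⟨m, hm, hm1⟩
    · rintro c ⟨-, hc⟩ c' ⟨-, hc'⟩ heq
      rw [← hout c, ← hout c']
      exact (hF _ _).2 ⟨hc.trans hc'.symm, sub_left_injective (congrArg Prod.fst heq)⟩
  have hsum : (PowerSeries.mk fun k =>
      ({c : RightCosets F | cosetWeight F ω c ≤ k}.ncard : ℤ)) = ∑ q, growthSeries h (Y q) := by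
    ext k
    rw [map_sum]
    simp only [growthSeries, PowerSeries.coeff_mk, ← hcard]
    norm_cast
    have hA := finite_setOf_cosetWeight_le (F := F) hfin hω hS k
    rw [Set.ncard_eq_toFinset_card _ hA, Finset.card_eq_sum_card_fiberwise
      (f := fun c : RightCosets F => κ c.out) (t := Finset.univ) fun c _ => Finset.mem_univ _]
    refine Finset.sum_congr rfl fun q _ => ?_
    rw [← Set.ncard_coe_finset]
    congr 1
    ext c
    simp
  rw [cosetGrowthSeries_eq hfin hω hS, hsum]
  refine IsRational.mul ?_ (IsRational.sum _ fun q _ => (hY q).isRational_growthSeries h h0 hlevel)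
  simpa using (IsRational.coe 1).sub (IsRational.coe X)

open scoped IsMulCommutative in
/-- A right coset of `F` in `G` is determined by its image in `G ⧸ Z` and by the class modulo `F`
of its position relative to a fixed transversal of `Z`. -/
theorem isRational_cosetGrowthSeries {Z : Subgroup G} [Z.Normal] [Z.FiniteIndex]
    [IsMulCommutative Z] (hfin : S.Finite) (hS : Submonoid.closure S = ⊤) (hω : ∀ s, 0 < ω s)
    (hF : F ≤ Z) : IsRational (cosetGrowthSeries F ω) := by
  let t : G ⧸ Z → G := Quotient.out
  have ht : ∀ q : G ⧸ Z, (t q : G ⧸ Z) = q := Quotient.out_eq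
  have hmem : ∀ g : G, g * (t g)⁻¹ ∈ Z := fun g => by
    rw [← QuotientGroup.eq_one_iff, QuotientGroup.mk_mul, QuotientGroup.mk_inv, ht,
      mul_inv_cancel]
  have hmem' : ∀ (q : G ⧸ Z) (s : S), t q * s * (t (q * (s : G)))⁻¹ ∈ Z := fun q s => by
    rw [← QuotientGroup.eq_one_iff, QuotientGroup.mk_mul, QuotientGroup.mk_mul,
      QuotientGroup.mk_inv, ht, ht, mul_inv_cancel]
  let π : Z → Additive (Z ⧸ F.subgroupOf Z) := fun z => Additive.ofMul (z : Z ⧸ F.subgroupOf Z)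
  refine isRational_cosetGrowthSeries_of_cocycle (Q := G ⧸ Z) hfin hS hω (fun g => (g : G ⧸ Z))
    (fun g => π ⟨g * (t g)⁻¹, hmem g⟩) (fun q s => q * (s : G))
    (fun q s => π ⟨t q * s * (t (q * (s : G)))⁻¹, hmem' q s⟩) (fun g s => rfl) ?_ ?_
  · intro g s
    -- Inserting `(t g)⁻¹ * t g` isolates a factor that depends only on the class of `g` and on `s`.
    have : (⟨g * s * (t (g * s : G))⁻¹, hmem (g * s)⟩ : Z) = ⟨g * (t g)⁻¹, hmem g⟩ *
        ⟨t g * s * (t ((g : G ⧸ Z) * (s : G)))⁻¹, hmem' g s⟩ := by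
      apply Subtype.ext
      simp [mul_assoc]
    exact congrArg π this
  · intro g g'
    have h1 : rightCoset F g = rightCoset F g' ↔ g' * g⁻¹ ∈ F :=
      Quotient.eq.trans QuotientGroup.rightRel_apply
    have h2 : π ⟨g * (t g)⁻¹, hmem g⟩ = π ⟨g' * (t g')⁻¹, hmem g'⟩ ↔
        (g' * (t g')⁻¹) * (g * (t g)⁻¹)⁻¹ ∈ F := by
      -- The quotient `Z ⧸ F.subgroupOf Z` compares left cosets; commutativity of `Z` turns this
      -- into the right-coset condition.
      have hcomm : (⟨g * (t g)⁻¹, hmem g⟩ : Z)⁻¹ * ⟨g' * (t g')⁻¹, hmem g'⟩ =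
        ⟨g' * (t g')⁻¹, hmem g'⟩ * (⟨g * (t g)⁻¹, hmem g⟩ : Z)⁻¹ := mul_comm _ _
      refine (Additive.ofMul.injective.eq_iff.trans QuotientGroup.eq).trans ?_
      rw [hcomm, Subgroup.mem_subgroupOf]
      rfl
    rw [h1, h2]
    have h3 : (g : G ⧸ Z) = g' → (g' * (t g')⁻¹) * (g * (t g)⁻¹)⁻¹ = g' * g⁻¹ := fun h => by
      rw [h]
      group
    constructor
    · intro h
      have hq : (g : G ⧸ Z) = g' := by
        rw [eq_comm, ← mul_inv_eq_one, ← QuotientGroup.mk_inv, ← QuotientGroup.mk_mul,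
          QuotientGroup.eq_one_iff]
        exact hF h
      exact ⟨hq, by rwa [h3 hq]⟩
    · rintro ⟨hq, h⟩
      rwa [h3 hq] at h

end Coset

end CosetGrowth

/-- `Z` is the normal finite-index subgroup of `G`, free abelian of rank `n`; the finite set `S`
generates `G` as a monoid and `ω` assigns a positive integer weight to each of its elements. -/
theorem theorem4p2 {G : Type*} [Group G] (n : ℕ) (Z : Subgroup G) [Z.Normal] [Z.FiniteIndex]
    (e : Z ≃* Multiplicative (Fin n → ℤ))
    (S : Set G) (hfin : S.Finite) (hS : Submonoid.closure S = ⊤)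
    (ω : S → ℕ) (hω : ∀ s, 0 < ω s)
    (F : Subgroup G) (hF : F ≤ Z) :
    CosetGrowth.IsRational (CosetGrowth.cosetGrowthSeries F ω) := by
  have : IsMulCommutative Z := .of_comm fun x y => e.injective (by simp [mul_comm])
  exact CosetGrowth.isRational_cosetGrowthSeries hfin hS hω hF
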